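/- Let $\mathcal X$ be the set of density matrices of $n$ qubits, with distance $\|\rho-\sigma\|_1=\operatorname{tr}|\rho-\sigma|$. Let $\mathcal S\subseteq\mathcal X$ (the data manifold of encoded states) be a set of pure product states $|\phi\rangle\langle\phi|$, $|\phi\rangle=\bigotimes_{i=1}^n|\phi_i\rangle$ with single-qubit unit vectors $|\phi_i\rangle$; for example, states with $|\phi_i\rangle=\cos(\tfrac{\pi}{2}u_i)|0\rangle+\sin(\tfrac{\pi}{2}u_i)|1\rangle$, where $u$ ranges over a set of vectors in $[0,1]^n$. For $\sigma\in\mathcal X$ let $P(\sigma)=\bigotimes_{i=1}^n\operatorname{tr}_{\{j\ne i\}}(\sigma)$ be the product of its single-qubit marginals, and let $\tilde\sigma\in\mathcal S$ be an element of $\mathcal S$ closest to $P(\sigma)$ in trace norm (assumed to exist for every $\sigma\in\mathcal X$; ties may be broken arbitrarily). For a classifier $h:\mathcal X\to\mathcal L$ define the preprocessed classifier $\tilde h(\sigma)=h(\tilde\sigma)$. Let $\rho\in\mathcal S$ and assume that some element of $\mathcal S$ is labelled by $h$ differently from $\rho$. Put $$\varepsilon_{in}(\rho)=\inf\{\|\sigma-\rho\|_1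 : \sigma\in\mathcal S,\ h(\sigma)\ne h(\rho)\},\qquad \varepsilon_{unc}(\rho)=\inf\{\|\sigma-\rho\|_1 : \sigma\in\mathcal X,\ \tilde h(\sigma)\ne\tilde h(\rho)\}.$$ Then $\varepsilon_{in}(\rho)$ is unchanged if $h$ is replaced by $\tilde h$ in its definition, and $$2-2\left(1-\frac{\varepsilon_{in}(\rho)^2}{16}\right)^{1/n_e}\le\varepsilon_{unc}(\rho)\le\varepsilon_{in}(\rho),$$ where $n_e=n$ for even $n$ and $n_e=n+1$ for odd $n$. -/

import Mathlib

open scoped ComplexOrder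

noncomputable section

namespace QClassifier

/-- Computational basis labels of `n` qubits. -/
abbrev Cfg (n : ℕ) : Type := Fin n → Fin 2

/-- Density matrices on a finite-dimensional Hilbert space with orthonormal basis `ι`. -/
@[ext]
structure Density (ι : Type) [Fintype ι] where
  mat : Matrix ι ι ℂ
  posSemidef : mat.PosSemidef
  trace_eq_one : mat.trace = 1

/-- Density matrices of `n` qubits. -/
abbrev QState (n : ℕ) : Type := Density (Cfg n)

theorem isHermitian_sub {ι : Type} [Fintype ι] (ρ σ : Density ι) :
    (ρ.mat - σ.mat).IsHermitian :=
  ρ.posSemidef.isHermitian.sub σ.posSemidef.isHermitian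

/-- The trace norm `‖ρ - σ‖₁ = tr |ρ - σ|`, that is, the sum of the absolute values of the
eigenvalues (with multiplicity) of the Hermitian matrix `ρ - σ`. -/
def traceDist {ι : Type} [Fintype ι] [DecidableEq ι] (ρ σ : Density ι) : ℝ :=
  ∑ k, |(isHermitian_sub ρ σ).eigenvalues k|

/-- The configuration with entry `a` at qubit `i` and entries `w` at the other qubits. -/
def glue {n : ℕ} (i : Fin n) (w : {j : Fin n // j ≠ i} → Fin 2) (a : Fin 2) : Cfg n :=
  (Equiv.funSplitAt i (Fin 2)).symm (a, w)

/-- Partial trace over all qubits other than `i`. -/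
def marginalMatrix {n : ℕ} (A : Matrix (Cfg n) (Cfg n) ℂ) (i : Fin n) :
    Matrix (Fin 2) (Fin 2) ℂ :=
  ∑ w : {j : Fin n // j ≠ i} → Fin 2, A.submatrix (glue i w) (glue i w)

/-- The tensor product `A 0 ⊗ ⋯ ⊗ A (n - 1)` of single-qubit matrices. -/
def tensorMatrix {n : ℕ} (A : Fin n → Matrix (Fin 2) (Fin 2) ℂ) : Matrix (Cfg n) (Cfg n) ℂ :=
  Matrix.of fun x y => ∏ i, A i (x i) (y i)

theorem marginalMatrix_density {n : ℕ} (σ : QState n) (i : Fin n) :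
    (marginalMatrix σ.mat i).PosSemidef ∧ (marginalMatrix σ.mat i).trace = 1 := by
  constructor
  · exact Matrix.posSemidef_sum _ fun w _ => σ.posSemidef.submatrix _
  · refine Eq.trans ?_ σ.trace_eq_one
    simp only [marginalMatrix, Matrix.trace, Matrix.diag, Matrix.sum_apply, Matrix.submatrix_apply]
    rw [← (Equiv.funSplitAt i (Fin 2)).symm.sum_comp, Fintype.sum_prod_type]
    rfl

theorem tensorMatrix_density {n : ℕ} (A : Fin n → Matrix (Fin 2) (Fin 2) ℂ)
    (hA : ∀ i, (A i).PosSemidef ∧ (A i).trace = 1) :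
    (tensorMatrix A).PosSemidef ∧ (tensorMatrix A).trace = 1 := by
  constructor
  · have hB : ∀ i, ∃ B : Matrix (Fin 2) (Fin 2) ℂ, A i = B.conjTranspose * B := fun i => by
      open scoped MatrixOrder in
      exact CStarAlgebra.nonneg_iff_eq_star_mul_self.mp (hA i).1.nonneg
    choose B hB using hB
    have : tensorMatrix A = (tensorMatrix B).conjTranspose * tensorMatrix B := by
      ext x y
      simp only [tensorMatrix, Matrix.of_apply, Matrix.mul_apply, Matrix.conjTranspose_apply, hB,
        star_prod, ← Finset.prod_mul_distrib]
      rw [Finset.prod_univ_sum, Fintype.piFinset_univ]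
    rw [this]
    exact Matrix.posSemidef_conjTranspose_mul_self _
  · have h : ∏ i, ∑ a, A i a a = 1 := Finset.prod_eq_one fun i _ => (hA i).2
    rw [← h, Finset.prod_univ_sum, Fintype.piFinset_univ]
    rfl

/-- The map `P` that sends `σ` to the product state of its single-qubit marginals. -/
def productOfMarginals {n : ℕ} (σ : QState n) : QState n :=
  ⟨tensorMatrix (marginalMatrix σ.mat),
    (tensorMatrix_density _ (marginalMatrix_density σ)).1,
    (tensorMatrix_density _ (marginalMatrix_density σ)).2⟩

/-- `ρ = |φ⟩⟨φ|` for a product `|φ⟩ = |φ₁⟩ ⊗ ⋯ ⊗ |φₙ⟩` of single-qubit unit vectors. -/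
def IsPureProduct {n : ℕ} (ρ : QState n) : Prop :=
  ∃ φ : Fin n → EuclideanSpace ℂ (Fin 2), (∀ i, ‖φ i‖ = 1) ∧
    ∀ x y, ρ.mat x y = (∏ i, φ i (x i)) * star (∏ i, φ i (y i))

/-- `fit σ` is, for every state `σ`, an element of `S` closest in trace norm to the product state
of the single-qubit marginals of `σ`. -/
def IsClosestFit {n : ℕ} (S : Set (QState n)) (fit : QState n → QState n) : Prop :=
  ∀ σ, fit σ ∈ S ∧ ∀ s ∈ S,
    traceDist (productOfMarginals σ) (fit σ) ≤ traceDist (productOfMarginals σ) s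

/-- The preprocessed classifier, which evaluates `h` on the fitted state. -/
def preprocessed {n : ℕ} {L : Type*} (h : QState n → L) (fit : QState n → QState n) :
    QState n → L :=
  fun σ => h (fit σ)

/-- The trace-norm distance from `ρ` to the states of `A` that the classifier `h` labels
differently from `ρ`. -/
def robustness {n : ℕ} {L : Type*} (A : Set (QState n)) (h : QState n → L) (ρ : QState n) : ℝ :=
  sInf {t | ∃ σ ∈ A, h σ ≠ h ρ ∧ t = traceDist σ ρ}

/-- In-distribution robustness: adversarial examples are confined to the data manifold `S`. -/
def epsIn {n : ℕ} {L : Type*} (S : Set (QState n)) (h : QState n → L) (ρ : QState n) : ℝ :=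
  robustness S h ρ

/-- Unconstrained robustness: any density matrix may be an adversarial example. -/
def epsUnc {n : ℕ} {L : Type*} (h : QState n → L) (ρ : QState n) : ℝ :=
  robustness Set.univ h ρ

/-- `n` for even `n` and `n + 1` for odd `n`. -/
def nEven (n : ℕ) : ℕ := if Even n then n else n + 1

end QClassifier

end

/-!
Everything reduces to the scalars `⟪v, M v⟫` and one identity: if the Hermitian matrix `A` has
eigenvalues `λ j` and eigenbasis `b`, then `⟪v, A v⟫ = ∑ j, λ j * |⟪b j, v⟫|²`
(`expect_eq_sum_eigenvalues`). It gives the pinching inequality `∑ k, |⟪c k, A c k⟫| ≤ tr |A|` for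
every orthonormal basis `c`, hence symmetry and the triangle inequality of the trace distance, and
also `⟪v, (ρ - σ) v⟫ ≤ ‖ρ - σ‖₁ / 2` for unit `v`.

For the lower bound, let `ρ = |φ⟩⟨φ|` lie in the data manifold, let `δ = ‖σ - ρ‖₁`, and suppose that
the fitted state of `σ` is labelled differently from `ρ`. Minimality of the fit and the triangle
inequality give `ε_in ≤ ‖fit σ - ρ‖₁ ≤ 2 ‖P σ - ρ‖₁`. The Fuchs–van de Graaf inequality for a pure
state (`traceDist_sq_le`) bounds `‖P σ - ρ‖₁²` by `4 (1 - F)`, where `F = ⟨φ|P σ|φ⟩` is the product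
of the single-qubit fidelities `⟨φ i|σ_i|φ i⟩`. Each of these is at least `⟨φ|σ|φ⟩ ≥ 1 - δ / 2`,
because passing to a marginal does not decrease the fidelity with a product vector
(`expect_productVector_le_marginal`). Hence `F ≥ (1 - δ / 2) ^ n` when `δ ≤ 2`, so that
`(1 - δ / 2) ^ n ≤ 1 - ε_in² / 16`; raising the exponent from `n` to `n_e` only weakens this.

Fuchs–van de Graaf is proved without purifications. The traceless matrix `τ - |φ⟩⟨φ|` has at most one
negative eigenvalue, because `τ` is positive on the orthogonal complement of `φ`; so its trace norm
is twice the modulus of that eigenvalue, and `sq_eigenvalues_le` bounds the square of any eigenvalue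
by `1 - ⟨φ|τ|φ⟩`.

The upper bound and the invariance of `ε_in` hold because `P` fixes pure product states, so that the
fit is the identity on the data manifold.
-/

namespace QClassifier

open Matrix

/-! ### Expectation values and the spectral theorem -/

section Spectral

variable {ι : Type} [Fintype ι] [DecidableEq ι]

/-- The real part of `⟪v, M v⟫`: for Hermitian `M` and unit `v`, the expectation value of `M` in
the pure state `v`. -/
noncomputable def expect (M : Matrix ι ι ℂ) (v : EuclideanSpace ℂ ι) : ℝ :=
  (inner ℂ v (M.toEuclideanLin v)).re

theorem inner_toEuclideanLin_eq_sum (M : Matrix ι ι ℂ) (v : EuclideanSpace ℂ ι) :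
    inner ℂ v (M.toEuclideanLin v) = ∑ x, ∑ y, star (v x) * M x y * v y := by
  simp only [PiLp.inner_apply, RCLike.inner_apply, Matrix.toLpLin_apply, Matrix.mulVec, dotProduct,
    Finset.sum_mul]
  refine Finset.sum_congr rfl fun x _ => Finset.sum_congr rfl fun y _ => ?_
  rw [starRingEnd_apply]
  ring

theorem expect_eq_sum (M : Matrix ι ι ℂ) (v : EuclideanSpace ℂ ι) :
    expect M v = (∑ x, ∑ y, star (v x) * M x y * v y).re := by
  rw [expect, inner_toEuclideanLin_eq_sum]

theorem expect_sub (M N : Matrix ι ι ℂ) (v : EuclideanSpace ℂ ι) :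
    expect (M - N) v = expect M v - expect N v := by
  simp [expect]

theorem expect_nonneg {M : Matrix ι ι ℂ} (hM : M.PosSemidef) (v : EuclideanSpace ℂ ι) :
    0 ≤ expect M v := by
  have h := hM.re_dotProduct_nonneg v.ofLp
  have e : star v.ofLp ⬝ᵥ (M *ᵥ v.ofLp) = inner ℂ v (M.toEuclideanLin v) := by
    rw [EuclideanSpace.inner_eq_star_dotProduct, dotProduct_comm]
    rfl
  rw [e] at h
  exact h

theorem inner_toEuclideanLin_left {A : Matrix ι ι ℂ} (hA : A.IsHermitian)
    (v w : EuclideanSpace ℂ ι) :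
    inner ℂ (A.toEuclideanLin v) w = inner ℂ v (A.toEuclideanLin w) :=
  Matrix.isSymmetric_toEuclideanLin_iff.mpr hA v w

theorem ofReal_expect {A : Matrix ι ι ℂ} (hA : A.IsHermitian) (v : EuclideanSpace ℂ ι) :
    (expect A v : ℂ) = ∑ x, ∑ y, star (v x) * A x y * v y := by
  rw [← inner_toEuclideanLin_eq_sum]
  exact (Matrix.isSymmetric_toEuclideanLin_iff.mpr hA).coe_re_inner_self_apply v

theorem toEuclideanLin_eigenvectorBasis {A : Matrix ι ι ℂ} (hA : A.IsHermitian) (k : ι) :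
    A.toEuclideanLin (hA.eigenvectorBasis k) =
      (hA.eigenvalues k : ℂ) • hA.eigenvectorBasis k := by
  ext x
  have := congrFun (hA.mulVec_eigenvectorBasis k) x
  simpa [Matrix.toLpLin_apply] using this

theorem expect_eigenvectorBasis {A : Matrix ι ι ℂ} (hA : A.IsHermitian) (k : ι) :
    expect A (hA.eigenvectorBasis k) = hA.eigenvalues k := by
  simp [expect, toEuclideanLin_eigenvectorBasis]

theorem expect_eq_sum_eigenvalues {A : Matrix ι ι ℂ} (hA : A.IsHermitian)
    (v : EuclideanSpace ℂ ι) :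
    expect A v = ∑ j, hA.eigenvalues j * ‖inner ℂ (hA.eigenvectorBasis j) v‖ ^ 2 := by
  unfold expect
  rw [← hA.eigenvectorBasis.sum_inner_mul_inner, Complex.re_sum]
  refine Finset.sum_congr rfl fun j _ => ?_
  rw [← inner_toEuclideanLin_left hA, toEuclideanLin_eigenvectorBasis, inner_smul_left,
    Complex.conj_ofReal, mul_left_comm, ← inner_conj_symm v, Complex.conj_mul',
    ← Complex.ofReal_pow, ← Complex.ofReal_mul, Complex.ofReal_re]

/-- Pinching: the diagonal of a Hermitian matrix in any orthonormal basis has `ℓ¹` norm at most the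
trace norm. -/
theorem sum_abs_expect_le {A : Matrix ι ι ℂ} (hA : A.IsHermitian)
    (c : OrthonormalBasis ι ℂ (EuclideanSpace ℂ ι)) :
    ∑ k, |expect A (c k)| ≤ ∑ j, |hA.eigenvalues j| := by
  calc ∑ k, |expect A (c k)|
      ≤ ∑ k, ∑ j, |hA.eigenvalues j| * ‖inner ℂ (hA.eigenvectorBasis j) (c k)‖ ^ 2 := by
        refine Finset.sum_le_sum fun k _ => ?_
        rw [expect_eq_sum_eigenvalues hA]
        refine (Finset.abs_sum_le_sum_abs _ _).trans_eq (Finset.sum_congr rfl fun j _ => ?_)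
        rw [abs_mul, abs_of_nonneg (sq_nonneg ‖_‖)]
    _ = ∑ j, |hA.eigenvalues j| := by
        rw [Finset.sum_comm]
        refine Finset.sum_congr rfl fun j _ => ?_
        rw [← Finset.mul_sum, c.sum_sq_norm_inner_left]
        simp

theorem sum_eigenvalues_eq {A : Matrix ι ι ℂ} (hA : A.IsHermitian) :
    ∑ j, hA.eigenvalues j = A.trace.re := by
  rw [hA.trace_eq_sum_eigenvalues]
  simp

/-- For `w` orthogonal to a unit vector `u`, apply Bessel's inequality for `u` and `w` to each
eigenvector of `M`. -/
theorem expect_le_of_inner_eq_zero {M : Matrix ι ι ℂ} (hM : M.PosSemidef)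
    {u w : EuclideanSpace ℂ ι} (hu : ‖u‖ = 1) (huw : inner ℂ u w = 0) :
    expect M w ≤ ‖w‖ ^ 2 * (M.trace.re - expect M u) := by
  have hA := hM.isHermitian
  rw [expect_eq_sum_eigenvalues hA w, expect_eq_sum_eigenvalues hA u, ← sum_eigenvalues_eq hA,
    ← Finset.sum_sub_distrib, Finset.mul_sum]
  refine Finset.sum_le_sum fun j _ => ?_
  set b := hA.eigenvectorBasis j with hb
  have hb1 : ‖b‖ = 1 := hA.eigenvectorBasis.orthonormal.1 j
  have key : ‖inner ℂ b w‖ ^ 2 ≤ (1 - ‖inner ℂ b u‖ ^ 2) * ‖w‖ ^ 2 := by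
    have h1 : inner ℂ b w = inner ℂ (b - inner ℂ u b • u) w := by
      rw [inner_sub_left, inner_smul_left, huw]; simp
    have h2 : ‖b - inner ℂ u b • u‖ ^ 2 = 1 - ‖inner ℂ b u‖ ^ 2 := by
      rw [@norm_sub_sq ℂ, inner_smul_right, norm_smul, hu, hb1, norm_inner_symm u b,
        mul_comm, inner_mul_symm_re_eq_norm, norm_mul, norm_inner_symm u b]
      ring
    rw [h1, ← h2, ← mul_pow]
    exact pow_le_pow_left₀ (norm_nonneg _) (norm_inner_le_norm _ _) 2
  have := mul_le_mul_of_nonneg_left key (hM.eigenvalues_nonneg j)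
  linarith

theorem expect_le_trace {M : Matrix ι ι ℂ} (hM : M.PosSemidef)
    {w : EuclideanSpace ℂ ι} (hw : ‖w‖ = 1) : expect M w ≤ M.trace.re := by
  have hA := hM.isHermitian
  rw [expect_eq_sum_eigenvalues hA w, ← sum_eigenvalues_eq hA]
  refine Finset.sum_le_sum fun j _ => ?_
  refine mul_le_of_le_one_right (hM.eigenvalues_nonneg j) (pow_le_one₀ (norm_nonneg _) ?_)
  simpa [hw] using norm_inner_le_norm (𝕜 := ℂ) (hA.eigenvectorBasis j) w

/-! ### The trace distance -/

theorem traceDist_nonneg (ρ σ : Density ι) : 0 ≤ traceDist ρ σ :=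
  Finset.sum_nonneg fun _ _ => abs_nonneg _

theorem traceDist_eq_zero_iff {ρ σ : Density ι} : traceDist ρ σ = 0 ↔ ρ = σ := by
  unfold traceDist
  rw [Finset.sum_eq_zero_iff_of_nonneg fun _ _ => abs_nonneg _, Density.ext_iff, ← sub_eq_zero,
    ← (isHermitian_sub ρ σ).eigenvalues_eq_zero_iff]
  simp [funext_iff]

theorem sum_abs_expect_sub_le (ρ σ : Density ι)
    (c : OrthonormalBasis ι ℂ (EuclideanSpace ℂ ι)) :
    ∑ k, |expect ρ.mat (c k) - expect σ.mat (c k)| ≤ traceDist ρ σ := by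
  simp only [← expect_sub]
  exact sum_abs_expect_le (isHermitian_sub ρ σ) c

/-- Equality in the pinching inequality is attained at an eigenbasis. -/
theorem exists_traceDist_eq (ρ σ : Density ι) :
    ∃ c : OrthonormalBasis ι ℂ (EuclideanSpace ℂ ι),
      traceDist ρ σ = ∑ k, |expect ρ.mat (c k) - expect σ.mat (c k)| :=
  ⟨(isHermitian_sub ρ σ).eigenvectorBasis, by
    simp only [← expect_sub, expect_eigenvectorBasis, traceDist]⟩

theorem traceDist_comm (ρ σ : Density ι) : traceDist ρ σ = traceDist σ ρ := by
  have key : ∀ ρ σ : Density ι, traceDist ρ σ ≤ traceDist σ ρ := fun ρ σ => by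
    obtain ⟨c, hc⟩ := exists_traceDist_eq ρ σ
    simp only [hc, abs_sub_comm (expect ρ.mat _)]
    exact sum_abs_expect_sub_le σ ρ c
  exact (key ρ σ).antisymm (key σ ρ)

theorem traceDist_triangle (ρ σ τ : Density ι) :
    traceDist ρ τ ≤ traceDist ρ σ + traceDist σ τ := by
  obtain ⟨c, hc⟩ := exists_traceDist_eq ρ τ
  rw [hc]
  refine le_trans ?_ (add_le_add (sum_abs_expect_sub_le ρ σ c) (sum_abs_expect_sub_le σ τ c))
  rw [← Finset.sum_add_distrib]
  exact Finset.sum_le_sum fun k _ => abs_sub_le _ _ _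

theorem sum_eigenvalues_sub (ρ σ : Density ι) :
    ∑ k, (isHermitian_sub ρ σ).eigenvalues k = 0 := by
  rw [sum_eigenvalues_eq, trace_sub, ρ.trace_eq_one, σ.trace_eq_one]
  simp

/-- Only the positive eigenvalues of `ρ - σ` contribute, and as the trace vanishes, they add up to
half of the trace norm. -/
theorem expect_sub_le_traceDist (ρ σ : Density ι) {v : EuclideanSpace ℂ ι} (hv : ‖v‖ = 1) :
    expect ρ.mat v - expect σ.mat v ≤ traceDist ρ σ / 2 := by
  have hA := isHermitian_sub ρ σ
  have h1 : ∀ j, hA.eigenvalues j * ‖inner ℂ (hA.eigenvectorBasis j) v‖ ^ 2 ≤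
      (|hA.eigenvalues j| + hA.eigenvalues j) / 2 := fun j => by
    have hle : ‖inner ℂ (hA.eigenvectorBasis j) v‖ ^ 2 ≤ 1 := by
      refine pow_le_one₀ (norm_nonneg _) ?_
      simpa [hv] using norm_inner_le_norm (𝕜 := ℂ) (hA.eigenvectorBasis j) v
    rcases le_total 0 (hA.eigenvalues j) with h | h
    · rw [abs_of_nonneg h]
      linarith [mul_le_of_le_one_right h hle]
    · rw [abs_of_nonpos h]
      linarith [mul_nonpos_of_nonpos_of_nonneg h (sq_nonneg ‖inner ℂ (hA.eigenvectorBasis j) v‖)]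
  rw [← expect_sub, expect_eq_sum_eigenvalues hA]
  refine (Finset.sum_le_sum fun j _ => h1 j).trans_eq ?_
  rw [← Finset.sum_div, Finset.sum_add_distrib, sum_eigenvalues_sub, add_zero]
  rfl

/-! ### Distance to a pure state -/

/-- `ρ = |v⟩⟨v|` for the unit vector `v`. -/
def IsPureWith (ρ : Density ι) (v : EuclideanSpace ℂ ι) : Prop :=
  ‖v‖ = 1 ∧ ∀ x y, ρ.mat x y = v x * star (v y)

theorem IsPureWith.toEuclideanLin_apply {ρ : Density ι} {v : EuclideanSpace ℂ ι}
    (h : IsPureWith ρ v) (w : EuclideanSpace ℂ ι) :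
    ρ.mat.toEuclideanLin w = inner ℂ v w • v := by
  ext x
  simp only [Matrix.toLpLin_apply, mulVec, dotProduct, h.2, PiLp.smul_apply, smul_eq_mul,
    PiLp.inner_apply, RCLike.inner_apply, Finset.sum_mul, starRingEnd_apply]
  exact Finset.sum_congr rfl fun y _ => by ring

theorem IsPureWith.expect_eq {ρ : Density ι} {v : EuclideanSpace ℂ ι}
    (h : IsPureWith ρ v) (w : EuclideanSpace ℂ ι) :
    expect ρ.mat w = ‖inner ℂ v w‖ ^ 2 := by
  rw [expect, h.toEuclideanLin_apply, inner_smul_right, ← inner_conj_symm w v, Complex.mul_conj',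
    ← Complex.ofReal_pow, Complex.ofReal_re]

/-- Subtracting a pure state from `τ` creates at most one negative eigenvalue. -/
theorem eigenvalues_nonneg_of_ne {τ ρ : Density ι} {v : EuclideanSpace ℂ ι} (hρ : IsPureWith ρ v)
    {j k : ι} (hjk : j ≠ k) (hj : (isHermitian_sub τ ρ).eigenvalues j < 0) :
    0 ≤ (isHermitian_sub τ ρ).eigenvalues k := by
  by_contra! hk
  have hA := isHermitian_sub τ ρ
  set b := hA.eigenvectorBasis with hb
  -- a nonzero combination of the two eigenvectors orthogonal to `v`
  obtain ⟨x, y, hxy, h0⟩ : ∃ x y : ℂ, (x ≠ 0 ∨ y ≠ 0) ∧ inner ℂ v (x • b j + y • b k) = 0 := by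
    by_cases h : inner ℂ v (b k) = 0
    · exact ⟨0, 1, by simp, by simp [h]⟩
    · exact ⟨inner ℂ v (b k), -inner ℂ v (b j), Or.inl h, by
        simp only [inner_add_right, inner_smul_right]; ring⟩
  set w := x • b j + y • b k with hw
  have h1 : expect (τ.mat - ρ.mat) w = expect τ.mat w := by
    rw [expect_sub, hρ.expect_eq, h0]; simp
  have h2 := expect_nonneg τ.posSemidef w
  have h3 : expect (τ.mat - ρ.mat) w =
      hA.eigenvalues j * ‖x‖ ^ 2 + hA.eigenvalues k * ‖y‖ ^ 2 := by
    rw [expect_eq_sum_eigenvalues hA, ← hb]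
    have hi : ∀ l, inner ℂ (b l) w = (if l = j then x else 0) + (if l = k then y else 0) :=
      fun l => by
        simp only [hw, inner_add_right, inner_smul_right,
          orthonormal_iff_ite.mp b.orthonormal, mul_ite, mul_one, mul_zero]
    rw [Finset.sum_eq_add j k hjk]
    · simp [hi, hjk, hjk.symm]
    · intro l _ hl; simp [hi, hl.1, hl.2]
    · simp
    · simp
  have hx : hA.eigenvalues j * ‖x‖ ^ 2 ≤ 0 := mul_nonpos_of_nonpos_of_nonneg hj.le (sq_nonneg _)
  have hy : hA.eigenvalues k * ‖y‖ ^ 2 ≤ 0 := mul_nonpos_of_nonpos_of_nonneg hk.le (sq_nonneg _)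
  rcases hxy with h | h
  · have : hA.eigenvalues j * ‖x‖ ^ 2 < 0 := mul_neg_of_neg_of_pos hj (by positivity)
    linarith
  · have : hA.eigenvalues k * ‖y‖ ^ 2 < 0 := mul_neg_of_neg_of_pos hk (by positivity)
    linarith

/-- If `u` is a unit eigenvector of `τ - |v⟩⟨v|` with eigenvalue `l`, write `v = c • u + w` with
`w ⊥ u`, and put `a = |c|²`, `b = ⟪u, τ u⟫ = l + a`, `G = ⟪w, τ w⟫`. The eigenvalue equation gives
`⟪w, τ u⟫ = (1 - a) * conj c`, so `⟪v, τ v⟫ = a b + 2 a (1 - a) + G`, and the claim follows from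
`G ≤ (1 - a) (1 - b)` and the Cauchy–Schwarz inequality for the form of `τ`. -/
theorem sq_eigenvalues_le {τ ρ : Density ι} {v : EuclideanSpace ℂ ι} (hρ : IsPureWith ρ v)
    (j : ι) : (isHermitian_sub τ ρ).eigenvalues j ^ 2 ≤ 1 - expect τ.mat v := by
  have hA := isHermitian_sub τ ρ
  obtain ⟨l, hl⟩ : ∃ l, l = (isHermitian_sub τ ρ).eigenvalues j := ⟨_, rfl⟩
  obtain ⟨u, hu⟩ : ∃ u, u = (isHermitian_sub τ ρ).eigenvectorBasis j := ⟨_, rfl⟩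
  have hu1 : ‖u‖ = 1 := hu ▸ hA.eigenvectorBasis.orthonormal.1 j
  obtain ⟨c, hc⟩ : ∃ c, c = inner ℂ u v := ⟨_, rfl⟩
  obtain ⟨w, hw⟩ : ∃ w, w = v - c • u := ⟨_, rfl⟩
  have huu : inner ℂ u u = 1 := by simp [inner_self_eq_norm_sq_to_K, hu1]
  have huw : inner ℂ u w = 0 := by
    rw [hw, inner_sub_right, inner_smul_right, huu, hc]; simp
  have hvu : inner ℂ v u = star c := by rw [hc]; exact (inner_conj_symm v u).symm
  obtain ⟨a, ha⟩ : ∃ a, a = ‖c‖ ^ 2 := ⟨_, rfl⟩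
  have hcc : star c * c = (a : ℂ) := by
    rw [ha, Complex.ofReal_pow, ← Complex.conj_mul']; rfl
  have hwu : inner ℂ w u = 0 := by rw [← inner_conj_symm, huw]; simp
  have hwv : inner ℂ w v = ((1 - a : ℝ) : ℂ) := by
    rw [hw, inner_sub_left, inner_smul_left, ← hc, inner_self_eq_norm_sq_to_K, hρ.1]
    simp [← hcc]
  have hww : ‖w‖ ^ 2 = 1 - a := by
    have : inner ℂ w w = ((1 - a : ℝ) : ℂ) := by
      nth_rw 2 [hw]
      rw [inner_sub_right, inner_smul_right, hwu, hwv]; simp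
    rw [inner_self_eq_norm_sq_to_K] at this
    exact Complex.ofReal_injective (by simpa using this)
  have hτu : τ.mat.toEuclideanLin u = (l : ℂ) • u + star c • v := by
    have h := toEuclideanLin_eigenvectorBasis hA j
    rw [← hu, ← hl, map_sub, LinearMap.sub_apply, hρ.toEuclideanLin_apply, hvu] at h
    rw [← h]; abel
  have hwτu : inner ℂ w (τ.mat.toEuclideanLin u) = star c * ((1 - a : ℝ) : ℂ) := by
    rw [hτu, inner_add_right, inner_smul_right, inner_smul_right, hwu, hwv]; simp
  have huτw : inner ℂ u (τ.mat.toEuclideanLin w) = c * ((1 - a : ℝ) : ℂ) := by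
    rw [← inner_toEuclideanLin_left τ.posSemidef.isHermitian, ← inner_conj_symm, hwτu]
    simp
  have hb : expect τ.mat u = l + a := by
    rw [expect, hτu, inner_add_right, inner_smul_right, inner_smul_right, huu, ← hc, hcc]
    simp
  have hq : ∀ t : ℝ, expect τ.mat (((t : ℂ) * c) • u + w) =
      t ^ 2 * (a * (l + a)) + t * (2 * a * (1 - a)) + expect τ.mat w := fun t => by
    have e1 : inner ℂ (((t : ℂ) * c) • u + w)
        (τ.mat.toEuclideanLin (((t : ℂ) * c) • u + w)) =
        ((t ^ 2 * a : ℝ) : ℂ) * inner ℂ u (τ.mat.toEuclideanLin u) +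
          ((t * (2 * a * (1 - a)) : ℝ) : ℂ) + inner ℂ w (τ.mat.toEuclideanLin w) := by
      simp only [map_add, map_smul, inner_add_left, inner_add_right, inner_smul_left,
        inner_smul_right, huτw, hwτu, map_mul, Complex.conj_ofReal]
      push_cast
      rw [← hcc, ← starRingEnd_apply]
      ring
    rw [expect, e1, ← hb, expect, expect, Complex.add_re, Complex.add_re, Complex.re_ofReal_mul,
      Complex.ofReal_re]
    ring
  -- Cauchy–Schwarz for the form of `τ`, read off from its values on the line `t • c • u + w`
  have hdisc := discrim_le_zero (a := a * (l + a)) (b := 2 * a * (1 - a)) (c := expect τ.mat w)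
    fun t => by
      have := expect_nonneg τ.posSemidef (((t : ℂ) * c) • u + w)
      rw [hq] at this
      linarith
  have hF : expect τ.mat v = a * (l + a) + 2 * a * (1 - a) + expect τ.mat w := by
    have := hq 1
    have e : (((1 : ℝ) : ℂ) * c) • u + w = v := by rw [hw]; simp
    rw [e] at this
    linarith
  have hG : expect τ.mat w ≤ (1 - a) * (1 - (l + a)) := by
    have := expect_le_of_inner_eq_zero τ.posSemidef hu1 huw
    rwa [hww, hb, τ.trace_eq_one, Complex.one_re] at this
  have hb0 : 0 ≤ l + a := hb ▸ expect_nonneg τ.posSemidef u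
  have hb1 : l + a ≤ 1 := by
    have := expect_le_trace τ.posSemidef hu1
    rwa [hb, τ.trace_eq_one, Complex.one_re] at this
  have ha0 : 0 ≤ a := ha ▸ sq_nonneg _
  have ha1 : 0 ≤ 1 - a := hww ▸ sq_nonneg _
  rw [← hl]
  obtain ⟨b, hbdef⟩ : ∃ b, b = l + a := ⟨_, rfl⟩
  obtain ⟨G, hGdef⟩ : ∃ G, G = expect τ.mat w := ⟨_, rfl⟩
  obtain rfl : l = b - a := by linarith
  rw [← hGdef] at hdisc hF hG
  rw [← hbdef] at hdisc hF hG hb0 hb1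
  rw [hF]
  -- the gap between the two sides of the claim is at least `b * (1 - b) - a * (1 - a)`
  have main : a * (1 - a) ≤ b * (1 - b) := by
    have hbb : 0 ≤ b * (1 - b) := mul_nonneg hb0 (by linarith)
    rcases ha0.eq_or_lt with h | h
    · rw [← h]; simpa using hbb
    rcases ha1.eq_or_lt with h' | h'
    · rw [← h']; simpa using hbb
    have h1 : a * (a * (1 - a) ^ 2) ≤ a * (b * G) := by
      unfold discrim at hdisc; linarith
    have h2 := le_of_mul_le_mul_left h1 h
    have h3 : (1 - a) * (a * (1 - a)) ≤ (1 - a) * (b * (1 - b)) := by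
      linarith [mul_le_mul_of_nonneg_left hG hb0]
    exact le_of_mul_le_mul_left h3 h'
  linarith

/-- The Fuchs–van de Graaf inequality for a pure state. -/
theorem traceDist_sq_le {τ ρ : Density ι} {v : EuclideanSpace ℂ ι}
    (hρ : IsPureWith ρ v) : traceDist τ ρ ^ 2 ≤ 4 * (1 - expect τ.mat v) := by
  have hsum := sum_eigenvalues_sub τ ρ
  unfold traceDist
  by_cases h : ∃ j, (isHermitian_sub τ ρ).eigenvalues j < 0
  · obtain ⟨j, hj⟩ := h
    have e : ∑ k, |(isHermitian_sub τ ρ).eigenvalues k| =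
        -2 * (isHermitian_sub τ ρ).eigenvalues j := by
      rw [← Finset.add_sum_erase _ _ (Finset.mem_univ j)] at hsum ⊢
      rw [abs_of_neg hj, Finset.sum_congr rfl fun k hk =>
        abs_of_nonneg (eigenvalues_nonneg_of_ne hρ (Finset.ne_of_mem_erase hk).symm hj)]
      linarith
    rw [e]
    linarith [sq_eigenvalues_le (τ := τ) hρ j]
  · push Not at h
    rw [Finset.sum_congr rfl fun k _ => abs_of_nonneg (h k), hsum]
    have := expect_le_trace τ.posSemidef hρ.1
    rw [τ.trace_eq_one, Complex.one_re] at this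
    linarith

end Spectral

/-! ### Product states and marginals -/

section Product

/-- The product vector `⨂ j, φ j`, with one tensor factor for each element of `J`. -/
noncomputable def productVector {J : Type} [Fintype J] [DecidableEq J]
    (φ : J → EuclideanSpace ℂ (Fin 2)) : EuclideanSpace ℂ (J → Fin 2) :=
  WithLp.toLp 2 fun x => ∏ j, φ j (x j)

theorem norm_productVector {J : Type} [Fintype J] [DecidableEq J]
    {φ : J → EuclideanSpace ℂ (Fin 2)} (hφ : ∀ j, ‖φ j‖ = 1) : ‖productVector φ‖ = 1 := by
  have h : ‖productVector φ‖ ^ 2 = ∏ j, ‖φ j‖ ^ 2 := by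
    simp only [EuclideanSpace.norm_sq_eq, productVector, norm_prod, ← Finset.prod_pow]
    rw [Finset.prod_univ_sum, Fintype.piFinset_univ]
  simp only [hφ, one_pow, Finset.prod_const_one] at h
  exact (pow_eq_one_iff_of_nonneg (norm_nonneg _) two_ne_zero).mp h

theorem isPureProduct_iff {n : ℕ} {ρ : QState n} :
    IsPureProduct ρ ↔ ∃ φ : Fin n → EuclideanSpace ℂ (Fin 2),
      (∀ i, ‖φ i‖ = 1) ∧ ∀ x y, ρ.mat x y = productVector φ x * star (productVector φ y) :=
  Iff.rfl

variable {n : ℕ}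

theorem glue_self (i : Fin n) (w : {j : Fin n // j ≠ i} → Fin 2) (a : Fin 2) :
    glue i w a i = a := by
  simp [glue, Equiv.funSplitAt]

theorem glue_of_ne (i : Fin n) (w : {j : Fin n // j ≠ i} → Fin 2) (a : Fin 2)
    (j : {j : Fin n // j ≠ i}) : glue i w a j = w j := by
  simp [glue, Equiv.funSplitAt, j.2]

theorem sum_glue (i : Fin n) (f : Cfg n → ℂ) :
    ∑ x, f x = ∑ w, ∑ a, f (glue i w a) := by
  rw [← (Equiv.funSplitAt i (Fin 2)).symm.sum_comp, Fintype.sum_prod_type, Finset.sum_comm]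
  rfl

theorem productVector_glue (φ : Fin n → EuclideanSpace ℂ (Fin 2)) (i : Fin n)
    (w : {j : Fin n // j ≠ i} → Fin 2) (a : Fin 2) :
    productVector φ (glue i w a) =
      φ i a * productVector (fun j : {j : Fin n // j ≠ i} => φ j) w := by
  simp only [productVector]
  rw [← Finset.mul_prod_erase _ _ (Finset.mem_univ i), glue_self]
  congr 1
  rw [Finset.prod_subtype (p := fun j => j ≠ i) (Finset.univ.erase i) (by simp)]
  exact Finset.prod_congr rfl fun j _ => by rw [glue_of_ne]

/-- Contracting `σ` with `φ i` at qubit `i` leaves a positive semidefinite matrix `T` on the other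
qubits. Its trace is the fidelity of the marginal with `φ i`, and its expectation in the unit vector
`⨂ j ≠ i, φ j` is the fidelity of `σ` with the full product vector. -/
theorem expect_productVector_le_marginal (σ : QState n) {φ : Fin n → EuclideanSpace ℂ (Fin 2)}
    (hφ : ∀ i, ‖φ i‖ = 1) (i : Fin n) :
    expect σ.mat (productVector φ) ≤ expect (marginalMatrix σ.mat i) (φ i) := by
  let W := {j : Fin n // j ≠ i} → Fin 2
  let e : W × Fin 2 → Cfg n := fun p => glue i p.1 p.2
  let V : Matrix (W × Fin 2) W ℂ := of fun p w => if p.1 = w then φ i p.2 else 0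
  let T : Matrix W W ℂ := Vᴴ * σ.mat.submatrix e e * V
  have hT : T.PosSemidef := (σ.posSemidef.submatrix e).conjTranspose_mul_mul_same V
  have hTe : ∀ w w', T w w' =
      ∑ a, ∑ b, star (φ i a) * σ.mat (glue i w a) (glue i w' b) * φ i b := fun w w' => by
    simp only [T, V, e, mul_apply, conjTranspose_apply, of_apply, submatrix_apply, mul_ite,
      mul_zero, apply_ite star, star_zero, ite_mul, zero_mul, Fintype.sum_prod_type,
      Finset.sum_ite_irrel, Finset.sum_const_zero, Finset.sum_ite_eq', Finset.mem_univ, if_true,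
      Finset.sum_mul]
    rw [Finset.sum_comm]
  have h1 : expect σ.mat (productVector φ) =
      expect T (productVector fun j : {j : Fin n // j ≠ i} => φ j) := by
    rw [expect_eq_sum, expect_eq_sum, sum_glue i]
    congr 1
    refine Finset.sum_congr rfl fun w _ => ?_
    simp only [sum_glue i, hTe, productVector_glue, star_mul', Finset.mul_sum, Finset.sum_mul]
    rw [Finset.sum_comm]
    refine Finset.sum_congr rfl fun w' _ => Finset.sum_congr rfl fun a _ =>
      Finset.sum_congr rfl fun b _ => ?_
    ring
  have h2 : T.trace.re = expect (marginalMatrix σ.mat i) (φ i) := by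
    rw [expect_eq_sum]
    congr 1
    simp only [trace, diag_apply, hTe, marginalMatrix, Matrix.sum_apply, submatrix_apply,
      Finset.mul_sum, Finset.sum_mul]
    rw [Finset.sum_comm]
    exact Finset.sum_congr rfl fun a _ => Finset.sum_comm
  rw [h1, ← h2]
  exact expect_le_trace hT (norm_productVector fun j => hφ j)

theorem expect_tensorMatrix (A : Fin n → Matrix (Fin 2) (Fin 2) ℂ)
    (hA : ∀ i, (A i).IsHermitian) (φ : Fin n → EuclideanSpace ℂ (Fin 2)) :
    expect (tensorMatrix A) (productVector φ) = ∏ i, expect (A i) (φ i) := by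
  have hT : (tensorMatrix A).IsHermitian := by
    ext x y
    simp only [conjTranspose_apply, tensorMatrix, of_apply, star_prod]
    exact Finset.prod_congr rfl fun i _ => (hA i).apply _ _
  apply Complex.ofReal_injective
  rw [ofReal_expect hT, Complex.ofReal_prod]
  simp only [ofReal_expect (hA _), Finset.prod_univ_sum, Fintype.piFinset_univ, productVector,
    tensorMatrix, of_apply, star_prod, ← Finset.prod_mul_distrib]

theorem productOfMarginals_eq_self {ρ : QState n} (h : IsPureProduct ρ) :
    productOfMarginals ρ = ρ := by
  obtain ⟨φ, hφ, hρ⟩ := isPureProduct_iff.mp h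
  have hm : ∀ i a b, marginalMatrix ρ.mat i a b = φ i a * star (φ i b) := fun i a b => by
    have h1 := norm_productVector (φ := fun j : {j : Fin n // j ≠ i} => φ j) fun j => hφ j
    have h2 : ∑ w, productVector (fun j : {j : Fin n // j ≠ i} => φ j) w *
        star (productVector (fun j : {j : Fin n // j ≠ i} => φ j) w) = 1 := by
      have h3 := EuclideanSpace.norm_sq_eq
        (productVector (fun j : {j : Fin n // j ≠ i} => φ j))
      rw [h1] at h3
      have h4 : ((1 ^ 2 : ℝ) : ℂ) = _ := congrArg Complex.ofReal h3
      push_cast at h4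
      rw [one_pow] at h4
      rw [h4]
      exact Finset.sum_congr rfl fun w _ => Complex.mul_conj' _
    simp only [marginalMatrix, Matrix.sum_apply, submatrix_apply, hρ, productVector_glue, star_mul']
    rw [← mul_one (φ i a * star (φ i b)), ← h2, Finset.mul_sum]
    exact Finset.sum_congr rfl fun w _ => by ring
  ext x y
  simp only [productOfMarginals, tensorMatrix, of_apply, hm, hρ, productVector, star_prod,
    Finset.prod_mul_distrib]

/-- The truncation `max 0` keeps the power meaningful when `‖σ - ρ‖₁ > 2` is not excluded. -/
theorem traceDist_productOfMarginals_sq_le {ρ : QState n} (hρ : IsPureProduct ρ) (σ : QState n) :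
    traceDist (productOfMarginals σ) ρ ^ 2 ≤ 4 * (1 - max 0 (1 - traceDist σ ρ / 2) ^ n) := by
  obtain ⟨φ, hφ, hm⟩ := isPureProduct_iff.mp hρ
  have hpure : IsPureWith ρ (productVector φ) := ⟨norm_productVector hφ, hm⟩
  refine (traceDist_sq_le hpure).trans
    (mul_le_mul_of_nonneg_left (sub_le_sub_left ?_ 1) zero_le_four)
  have hmarg : ∀ i, (1 - traceDist σ ρ / 2) ≤ expect (marginalMatrix σ.mat i) (φ i) := fun i => by
    have h1 := expect_sub_le_traceDist ρ σ hpure.1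
    have h2 : expect ρ.mat (productVector φ) = 1 := by
      rw [hpure.expect_eq, inner_self_eq_norm_sq_to_K, hpure.1]; simp
    have h3 := expect_productVector_le_marginal σ hφ i
    rw [traceDist_comm ρ σ] at h1
    linarith
  change _ ≤ expect (tensorMatrix _) _
  rw [expect_tensorMatrix _ fun i => (marginalMatrix_density σ i).1.isHermitian]
  calc _ = ∏ _i : Fin n, max 0 (1 - traceDist σ ρ / 2) := by simp
    _ ≤ _ := Finset.prod_le_prod (fun _ _ => le_max_left _ _) fun i _ =>
      max_le (expect_nonneg (marginalMatrix_density σ i).1 _) (hmarg i)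

end Product

/-! ### Robustness of the fitted classifier -/

section Robustness

variable {n : ℕ} {L : Type*}

theorem IsClosestFit.eq_self {S : Set (QState n)} {fit : QState n → QState n}
    (hfit : IsClosestFit S fit) (hS : ∀ s ∈ S, IsPureProduct s) {s : QState n} (hs : s ∈ S) :
    fit s = s := by
  have h := (hfit s).2 s hs
  rw [productOfMarginals_eq_self (hS s hs), traceDist_eq_zero_iff.mpr rfl] at h
  exact (traceDist_eq_zero_iff.mp (h.antisymm (traceDist_nonneg _ _))).symm

theorem IsClosestFit.traceDist_le {S : Set (QState n)} {fit : QState n → QState n}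
    (hfit : IsClosestFit S fit) (σ : QState n) {s : QState n} (hs : s ∈ S) :
    traceDist (fit σ) s ≤ 2 * traceDist (productOfMarginals σ) s := by
  have h1 := (hfit σ).2 s hs
  have h2 := traceDist_triangle (fit σ) (productOfMarginals σ) s
  rw [traceDist_comm (fit σ) (productOfMarginals σ)] at h2
  linarith

theorem robustness_nonneg (A : Set (QState n)) (h : QState n → L) (ρ : QState n) :
    0 ≤ robustness A h ρ := by
  refine Real.sInf_nonneg ?_
  rintro t ⟨σ, _, _, rfl⟩
  exact traceDist_nonneg σ ρ

theorem robustness_le {A : Set (QState n)} {h : QState n → L} {ρ σ : QState n}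
    (hσ : σ ∈ A) (hne : h σ ≠ h ρ) : robustness A h ρ ≤ traceDist σ ρ := by
  refine csInf_le ⟨0, ?_⟩ ⟨σ, hσ, hne, rfl⟩
  rintro t ⟨σ, _, _, rfl⟩
  exact traceDist_nonneg σ ρ

theorem le_robustness {A : Set (QState n)} {h : QState n → L} {ρ : QState n} {r : ℝ}
    (hadv : ∃ σ ∈ A, h σ ≠ h ρ) (hr : ∀ σ ∈ A, h σ ≠ h ρ → r ≤ traceDist σ ρ) :
    r ≤ robustness A h ρ := by
  obtain ⟨σ, hσ, hne⟩ := hadv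
  refine le_csInf ⟨_, σ, hσ, hne, rfl⟩ ?_
  rintro t ⟨σ, hσ, hne, rfl⟩
  exact hr σ hσ hne

theorem le_nEven (n : ℕ) : n ≤ nEven n := by
  unfold nEven; split_ifs <;> omega

/-- The single-qubit fidelity bound, solved for the distance `d`. -/
theorem two_sub_two_mul_rpow_le {n : ℕ} {d x : ℝ} (hd : 0 ≤ d) (h : max 0 (1 - d / 2) ^ n ≤ x) :
    2 - 2 * x ^ ((1 : ℝ) / (nEven n : ℝ)) ≤ d := by
  have hy0 : (0 : ℝ) ≤ max 0 (1 - d / 2) := le_max_left _ _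
  have hy1 : max 0 (1 - d / 2) ≤ 1 := max_le zero_le_one (by linarith)
  suffices hs : max 0 (1 - d / 2) ≤ x ^ ((1 : ℝ) / (nEven n : ℝ)) by
    linarith [le_max_right 0 (1 - d / 2)]
  rcases Nat.eq_zero_or_pos (nEven n) with hn | hn
  · -- here `1 / 0 = 0`, and the right-hand side is `1`
    simpa [hn] using hy1
  calc max 0 (1 - d / 2)
      = (max 0 (1 - d / 2) ^ nEven n) ^ ((1 : ℝ) / (nEven n : ℝ)) := by
        rw [one_div, Real.pow_rpow_inv_natCast hy0 hn.ne']
    _ ≤ x ^ ((1 : ℝ) / (nEven n : ℝ)) :=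
        Real.rpow_le_rpow (pow_nonneg hy0 _)
          ((pow_le_pow_of_le_one hy0 hy1 (le_nEven n)).trans h) (by positivity)

end Robustness

end QClassifier

theorem theorem3 {n : ℕ} {L : Type*}
    (S : Set (QClassifier.QState n)) (hS : ∀ s ∈ S, QClassifier.IsPureProduct s)
    (h : QClassifier.QState n → L)
    (fit : QClassifier.QState n → QClassifier.QState n)
    (hfit : QClassifier.IsClosestFit S fit)
    (ρ : QClassifier.QState n) (hρ : ρ ∈ S)
    (hadv : ∃ σ ∈ S, h σ ≠ h ρ) :
    2 - 2 * (1 - QClassifier.epsIn S h ρ ^ 2 / 16) ^ ((1 : ℝ) / (QClassifier.nEven n : ℝ))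
        ≤ QClassifier.epsUnc (QClassifier.preprocessed h fit) ρ ∧
      QClassifier.epsUnc (QClassifier.preprocessed h fit) ρ ≤ QClassifier.epsIn S h ρ ∧
      QClassifier.epsIn S (QClassifier.preprocessed h fit) ρ = QClassifier.epsIn S h ρ := by
  open QClassifier in
  have hself : ∀ s ∈ S, preprocessed h fit s = h s := fun s hs =>
    congrArg h (hfit.eq_self hS hs)
  have hadv' : ∃ σ ∈ Set.univ, preprocessed h fit σ ≠ preprocessed h fit ρ := by
    obtain ⟨σ, hσ, hne⟩ := hadv
    exact ⟨σ, Set.mem_univ σ, by rwa [hself σ hσ, hself ρ hρ]⟩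
  refine ⟨le_robustness hadv' fun σ _ hσ => ?_, le_robustness hadv fun σ hσ hne => ?_, ?_⟩
  · rw [hself ρ hρ] at hσ
    have h1 : epsIn S h ρ ≤ traceDist (fit σ) ρ := robustness_le (hfit σ).1 hσ
    have h2 := hfit.traceDist_le σ hρ
    have h3 := traceDist_productOfMarginals_sq_le (hS ρ hρ) σ
    have h4 := pow_le_pow_left₀ (robustness_nonneg S h ρ) (h1.trans h2) 2
    refine two_sub_two_mul_rpow_le (traceDist_nonneg σ ρ) ?_
    change _ ≤ 1 - robustness S h ρ ^ 2 / 16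
    linarith
  · exact robustness_le (Set.mem_univ σ) (by rwa [hself σ hσ, hself ρ hρ])
  · unfold epsIn robustness
    congr 1
    ext t
    refine exists_congr fun σ => and_congr_right fun hσ => ?_
    rw [hself σ hσ, hself ρ hρ]
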